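/- Let $K$ be a compact Hausdorff topological space, and let $C_p(K)$ be the set of all continuous functions $K\to\mathbb{R}$ endowed with the topology of pointwise convergence, i.e. the subspace topology inherited from the product space $\mathbb{R}^K$. A topological space $X$ is called a $k_{\mathbb{R}}$-space if a function $f:X\to\mathbb{R}$ is continuous if and only if its restriction $f|_C$ to every compact subset $C\subseteq X$ is continuous. A topological space is called scattered if each of its nonempty subsets $S$ has a point that is isolated in the subspace $S$. Then $C_p(K)$ is a $k_{\mathbb{R}}$-space if and only if $K$ is scattered. -/

import Mathlib

/-- A topological space is scattered if every nonempty subset `S` has an isolated point,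
i.e. a point `x` of `S` such that `{x}` is open in the subspace `S`. -/
def IsScatteredSpace (X : Type*) [TopologicalSpace X] : Prop :=
  ∀ S : Set X, S.Nonempty → ∃ x ∈ S, ∃ U : Set X, IsOpen U ∧ U ∩ S = {x}

/-- A topological space is a `k_ℝ`-space if a real-valued function on it is continuous if and
only if its restriction to every compact subset is continuous. -/
def IsKRSpace (X : Type*) [TopologicalSpace X] : Prop :=
  ∀ f : X → ℝ, Continuous f ↔ ∀ C : Set X, IsCompact C → ContinuousOn f C

/-- `C_p(X)`: the set of continuous real-valued functions on `X`. As a subtype of `X → ℝ` it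
carries the subspace topology of the product topology, i.e. the topology of pointwise
convergence. -/
abbrev Cp (X : Type*) [TopologicalSpace X] : Type _ :=
  {f : X → ℝ // Continuous f}

open Set Filter Topology MeasureTheory

universe u

/-! If `K` is scattered, `C_p(K)` is Fréchet–Urysohn. Countable tightness reduces to a countable
`B`; evaluation on `B` maps `K` onto a compact subset of `ℝ^B`, countable because it contains no
nonempty perfect set, so `closure B` embeds in a countable power of `ℝ`. A convergent sequence with
its limit is compact, so continuity on compact sets gives continuity.

If `K` is not scattered, a dyadic scheme in a perfect set yields a diffuse probability measure `μ`.
Then `f ↦ ∫ min |f| 1 ∂μ` is sequentially continuous by dominated convergence, hence continuous on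
compact sets, which are Fréchet–Urysohn for every compact `K`. It is discontinuous at `0`: a
function can vanish on a given finite set and still have large integral. -/

/-! ### Closures and countable tightness in the pointwise topology -/

theorem Cp.mem_closure_iff {X : Type*} [TopologicalSpace X] {A : Set (Cp X)} {f : Cp X} :
    f ∈ closure A ↔ ∀ (T : Finset X) (ε : ℝ), 0 < ε →
      ∃ a ∈ A, ∀ x ∈ T, dist (a.1 x) (f.1 x) < ε := by
  have hb := (hasBasis_pi fun i => Metric.nhds_basis_ball (x := f.1 i)).comap
    (Subtype.val : Cp X → X → ℝ)
  rw [← nhds_pi, ← nhds_induced] at hb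
  rw [mem_closure_iff_nhds_basis hb]
  constructor
  · intro h T ε hε
    obtain ⟨a, ha, haf⟩ := h (↑T, fun _ => ε) ⟨T.finite_toSet, fun _ _ => hε⟩
    exact ⟨a, ha, fun x hx => haf x hx⟩
  · rintro h ⟨I, r⟩ ⟨hI, hr⟩
    have h1 : ∀ᶠ ε in 𝓝[>] (0 : ℝ), ∀ i ∈ I, ε < r i := by
      rw [eventually_all_finite hI]
      exact fun i hi => (eventually_lt_nhds (hr i hi)).filter_mono nhdsWithin_le_nhds
    obtain ⟨ε, hε, hpos⟩ := (h1.and self_mem_nhdsWithin).exists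
    obtain ⟨a, ha, haf⟩ := h hI.toFinset ε hpos
    exact ⟨a, ha, fun x hx => (haf x (by simpa using hx)).trans (hε x hx)⟩

theorem Cp.tendsto_iff {X ι : Type*} [TopologicalSpace X] {l : Filter ι} {u : ι → Cp X}
    {f : Cp X} : Tendsto u l (𝓝 f) ↔ ∀ x, Tendsto (fun i => (u i).1 x) l (𝓝 (f.1 x)) := by
  rw [tendsto_subtype_rng, tendsto_pi_nhds]

theorem Cp.continuous_eval {X : Type*} [TopologicalSpace X] (x : X) :
    Continuous fun f : Cp X => f.1 x :=
  (continuous_apply x).comp continuous_subtype_val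

/-- Countable tightness of `C_p(K)`. -/
theorem Cp.exists_countable_mem_closure {K : Type*} [TopologicalSpace K] [CompactSpace K]
    {A : Set (Cp K)} {f : Cp K} (hf : f ∈ closure A) :
    ∃ B ⊆ A, B.Countable ∧ f ∈ closure B := by
  classical
  rw [Cp.mem_closure_iff] at hf
  -- Compactness of `K^n` lets finitely many members of `A` serve all `n`-tuples at once.
  have key : ∀ n m : ℕ, ∃ B ⊆ A, B.Finite ∧ ∀ x : Fin n → K,
      ∃ a ∈ B, ∀ i, dist (a.1 (x i)) (f.1 (x i)) < 1 / (m + 1 : ℝ) := by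
    intro n m
    let U : A → Set (Fin n → K) := fun a =>
      {x | ∀ i, dist (a.1.1 (x i)) (f.1 (x i)) < 1 / (m + 1 : ℝ)}
    have hU : ∀ a, IsOpen (U a) := by
      intro a
      simp only [U, ofPred_forall]
      refine isOpen_iInter_of_finite fun i => isOpen_lt ?_ continuous_const
      have := a.1.2
      have := f.2
      fun_prop
    have hcov : (univ : Set (Fin n → K)) ⊆ ⋃ a, U a := by
      intro x _
      obtain ⟨a, ha, h⟩ := hf (Finset.univ.image x) (1 / (m + 1 : ℝ)) (by positivity)
      exact mem_iUnion.2 ⟨⟨a, ha⟩, fun i => h _ (by simp)⟩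
    obtain ⟨t, ht⟩ := isCompact_univ.elim_finite_subcover U hU hcov
    refine ⟨Subtype.val '' (t : Set A), by simp, t.finite_toSet.image _, fun x => ?_⟩
    obtain ⟨a, ha, hx⟩ := mem_iUnion₂.1 (ht (mem_univ x))
    exact ⟨a, ⟨a, ha, rfl⟩, hx⟩
  choose B hBA hBf hB using key
  refine ⟨⋃ n, ⋃ m, B n m, by simp [hBA], ?_, ?_⟩
  · exact countable_iUnion fun n => countable_iUnion fun m => (hBf n m).countable
  · rw [Cp.mem_closure_iff]
    intro T ε hε
    obtain ⟨m, hm⟩ := exists_nat_one_div_lt hε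
    obtain ⟨a, ha, h⟩ := hB T.card m (fun i => (T.equivFin.symm i : K))
    refine ⟨a, mem_iUnion₂.2 ⟨_, _, ha⟩, fun x hx => ?_⟩
    simpa using (h (T.equivFin ⟨x, hx⟩)).trans (by simpa using hm)

theorem Cp.exists_seq_of_mem_closure {X : Type*} [TopologicalSpace X] {B : Set (Cp X)} {f : Cp X}
    (hf : f ∈ closure B) [FirstCountableTopology (closure B)] :
    ∃ u : ℕ → Cp X, (∀ n, u n ∈ B) ∧ Tendsto u atTop (𝓝 f) := by
  have : (⟨f, hf⟩ : closure B) ∈ closure (Subtype.val ⁻¹' B : Set (closure B)) := by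
    rw [closure_subtype, Subtype.image_preimage_coe, inter_eq_self_of_subset_right subset_closure]
    exact hf
  obtain ⟨u, hu, hlim⟩ := mem_closure_iff_seq_limit.1 this
  exact ⟨fun n => (u n).1, hu, tendsto_subtype_rng.1 hlim⟩

/-- Points that are not separated by `B` are not separated by the closure of `B`. -/
theorem Cp.eq_of_mem_closure {X : Type*} [TopologicalSpace X] {B : Set (Cp X)} {x y : X}
    (h : ∀ a ∈ B, a.1 x = a.1 y) {f : Cp X} (hf : f ∈ closure B) : f.1 x = f.1 y :=
  closure_minimal (t := {f : Cp X | f.1 x = f.1 y}) h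
    (isClosed_eq (Cp.continuous_eval x) (Cp.continuous_eval y)) hf

/-! ### Scattered compacta and the Fréchet–Urysohn property -/

/-- A perfect set in the image of a compact scattered space is empty. -/
theorem IsScatteredSpace.eq_empty_of_perfect {K Y : Type u} [TopologicalSpace K] [CompactSpace K]
    [T2Space K] [TopologicalSpace Y] [T2Space Y] (hK : IsScatteredSpace K) {e : K → Y}
    (he : Continuous e) {D : Set Y} (hD : Perfect D) (hDe : D ⊆ range e) : D = ∅ := by
  by_contra hne
  have : CompactSpace (e ⁻¹' D) := isCompact_iff_compactSpace.1 (hD.closed.preimage he).isCompact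
  let p : e ⁻¹' D → D := fun x => ⟨e x, x.2⟩
  have hp : Continuous p := by fun_prop
  have hps : p.Surjective := by
    rintro ⟨y, hy⟩
    obtain ⟨x, rfl⟩ := hDe hy
    exact ⟨⟨x, hy⟩, rfl⟩
  -- Take `E` minimal among closed sets mapping onto `D`. Deleting an isolated point `x` of `E` must
  -- lose a point of `D`, which can only be `p x`; so `p x` is isolated in `D`, against perfectness.
  obtain ⟨E, hE, hpE, hmin⟩ := exists_compact_surjective_zorn_subset hp hps
  obtain ⟨y, hy⟩ := nonempty_iff_ne_empty.2 hne
  obtain ⟨x₀, hx₀, -⟩ : (⟨y, hy⟩ : D) ∈ p '' E := hpE ▸ mem_univ _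
  obtain ⟨_, ⟨x, hxE, rfl⟩, U, hU, hUx⟩ := hK (Subtype.val '' E) ⟨_, x₀, hx₀, rfl⟩
  have hxU : x.1 ∈ U := (hUx.symm ▸ mem_singleton _ : x.1 ∈ U ∩ _).1
  let E₀ : Set E := {z | z.1.1 ∉ U}
  have hE₀ : IsClosed E₀ :=
    (hU.preimage (continuous_subtype_val.comp continuous_subtype_val)).isClosed_compl
  have him : E.domRestrict p '' E₀ ≠ univ :=
    hmin E₀ (fun h => (h ▸ mem_univ _ : (⟨x, hxE⟩ : E) ∈ E₀) hxU) hE₀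
  have hcl : IsClosed (E.domRestrict p '' E₀) :=
    (hE₀.isCompact.image (hp.comp continuous_subtype_val)).isClosed
  have hsub : ∀ z : D, z ≠ p x → z ∈ E.domRestrict p '' E₀ := by
    intro z hz
    obtain ⟨w, hw, rfl⟩ : z ∈ p '' E := hpE ▸ mem_univ _
    refine ⟨⟨w, hw⟩, fun hwU => hz ?_, rfl⟩
    have : w.1 = x.1 := by
      have : w.1 ∈ U ∩ Subtype.val '' E := ⟨hwU, w, hw, rfl⟩
      rwa [hUx] at this
    rw [Subtype.ext this]
  have hpx : p x ∉ E.domRestrict p '' E₀ := fun h =>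
    him (eq_univ_of_forall fun z => by
      by_cases hz : z = p x
      · exact hz ▸ h
      · exact hsub z hz)
  obtain ⟨V, hV, hVe⟩ := isOpen_induced_iff.1 hcl.isOpen_compl
  have hxV : e x ∈ V := by
    have : p x ∈ Subtype.val ⁻¹' V := by rw [hVe]; exact hpx
    exact this
  obtain ⟨z, ⟨hzV, hzD⟩, hzx⟩ := preperfect_iff_nhds.1 hD.acc (e x) x.2 V (hV.mem_nhds hxV)
  have h1 : (⟨z, hzD⟩ : D) ∈ (E.domRestrict p '' E₀)ᶜ := by rw [← hVe]; exact hzV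
  exact h1 (hsub _ fun h => hzx (congrArg Subtype.val h))

theorem IsScatteredSpace.countable_range {K Y : Type u} [TopologicalSpace K] [CompactSpace K]
    [T2Space K] [TopologicalSpace Y] [T2Space Y] [SecondCountableTopology Y]
    (hK : IsScatteredSpace K) {e : K → Y} (he : Continuous e) : (range e).Countable := by
  by_contra h
  obtain ⟨D, hD, hne, hsub⟩ :=
    exists_perfect_nonempty_of_isClosed_of_not_countable (isCompact_range he).isClosed h
  exact hne.ne_empty (hK.eq_empty_of_perfect he hD hsub)

/-- Members of `closure B` are constant on the fibres of `e`, so one sample point in each of the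
countably many fibres determines the whole pointwise topology. -/
theorem Cp.exists_seq_of_isScatteredSpace {K : Type*} [TopologicalSpace K] [CompactSpace K]
    [T2Space K] (hK : IsScatteredSpace K) {A : Set (Cp K)} {f : Cp K} (hf : f ∈ closure A) :
    ∃ u : ℕ → Cp K, (∀ n, u n ∈ A) ∧ Tendsto u atTop (𝓝 f) := by
  obtain ⟨B, hBA, hBc, hfB⟩ := Cp.exists_countable_mem_closure hf
  have := hBc.to_subtype
  let e : K → B → ℝ := fun x a => a.1.1 x
  have he : Continuous e := continuous_pi fun a => a.1.2
  have := (hK.countable_range he).to_subtype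
  choose s hs using fun y : range e => y.2
  let ρ : closure B → range e → ℝ := fun g y => g.1.1 (s y)
  have hfib : ∀ (g : closure B) (x : K), g.1.1 x = ρ g ⟨e x, x, rfl⟩ := fun g x =>
    Cp.eq_of_mem_closure (fun a ha => (congrFun (hs ⟨e x, x, rfl⟩) ⟨a, ha⟩).symm) g.2
  have hρ : IsInducing ρ := by
    refine isInducing_iff_nhds.2 fun g => le_antisymm ?_ ?_
    · exact (continuous_pi fun y => (Cp.continuous_eval _).comp continuous_subtype_val
        : Continuous ρ).continuousAt.le_comap
    · have : Tendsto (fun h : closure B => h.1) (comap ρ (𝓝 (ρ g))) (𝓝 g.1) := by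
        rw [Cp.tendsto_iff]
        intro x
        simp only [fun g => hfib g x]
        exact ((continuous_apply (⟨e x, x, rfl⟩ : range e)).tendsto (ρ g)).comp tendsto_comap
      exact tendsto_id'.1 (tendsto_subtype_rng.2 this)
  have := hρ.firstCountableTopology
  obtain ⟨u, hu, hlim⟩ := Cp.exists_seq_of_mem_closure hfB
  exact ⟨u, fun n => hBA (hu n), hlim⟩

/-! ### Sequences in compact subsets, and sufficiency of scatteredness -/

/-- Without scatteredness `range e` may be uncountable, but it is separable and members of `closure
B` descend to continuous functions on it. Sampling over a countable dense set is thus injective, and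
compactness of `closure B` makes it an embedding. -/
theorem Cp.exists_seq_of_isCompact {K : Type*} [TopologicalSpace K] [CompactSpace K]
    {C A : Set (Cp K)} (hC : IsCompact C) (hA : A ⊆ C) {f : Cp K} (hf : f ∈ closure A) :
    ∃ u : ℕ → Cp K, (∀ n, u n ∈ A) ∧ Tendsto u atTop (𝓝 f) := by
  obtain ⟨B, hBA, hBc, hfB⟩ := Cp.exists_countable_mem_closure hf
  have := hBc.to_subtype
  have : CompactSpace (closure B) := isCompact_iff_compactSpace.1
    (hC.of_isClosed_subset isClosed_closure (closure_minimal (hBA.trans hA) hC.isClosed))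
  let e : K → B → ℝ := fun x a => a.1.1 x
  have he : Continuous e := continuous_pi fun a => a.1.2
  let q : K → range e := rangeFactorization e
  have hq : IsQuotientMap q :=
    (he.rangeFactorization.isClosedMap).isQuotientMap he.rangeFactorization
      rangeFactorization_surjective
  obtain ⟨S, hSc, hSd⟩ := TopologicalSpace.exists_countable_dense (range e)
  have := hSc.to_subtype
  choose s hs using fun y : range e => y.2
  let ρ : closure B → S → ℝ := fun g y => g.1.1 (s y)
  have hfib : ∀ (g : closure B) (x : K), g.1.1 x = g.1.1 (s (q x)) := fun g x =>
    Cp.eq_of_mem_closure (fun a ha => (congrFun (hs (q x)) ⟨a, ha⟩).symm) g.2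
  have hcont : ∀ g : closure B, Continuous fun y : range e => g.1.1 (s y) := fun g =>
    hq.continuous_iff.2 (g.1.2.congr (hfib g))
  have hinj : Function.Injective ρ := by
    intro g h hgh
    have := Continuous.ext_on hSd (hcont g) (hcont h) fun y hy => congrFun hgh ⟨y, hy⟩
    ext x
    rw [hfib g, hfib h]
    exact congrFun this (q x)
  have hρ : Continuous ρ :=
    continuous_pi fun y => (Cp.continuous_eval _).comp continuous_subtype_val
  have := (hρ.isClosedEmbedding hinj).isInducing.firstCountableTopology
  obtain ⟨u, hu, hlim⟩ := Cp.exists_seq_of_mem_closure hfB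
  exact ⟨u, fun n => hBA (hu n), hlim⟩

theorem continuousWithinAt_of_seq {X : Type*} [TopologicalSpace X] {F : X → ℝ} {C : Set X} {x : X}
    (hC : ∀ A ⊆ C, x ∈ closure A → ∃ u : ℕ → X, (∀ n, u n ∈ A) ∧ Tendsto u atTop (𝓝 x))
    (hF : ∀ u : ℕ → X, (∀ n, u n ∈ C) → Tendsto u atTop (𝓝 x) →
      Tendsto (fun n => F (u n)) atTop (𝓝 (F x))) : ContinuousWithinAt F C x := by
  rw [ContinuousWithinAt, Metric.tendsto_nhds]
  intro ε hε
  by_contra h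
  have hx : x ∈ closure {y ∈ C | ε ≤ dist (F y) (F x)} := by
    rw [mem_closure_iff_frequently]
    refine (frequently_nhdsWithin_iff.1 (not_eventually.1 h)).mono fun y hy => ⟨hy.2, not_lt.1 hy.1⟩
  obtain ⟨u, hu, hlim⟩ := hC _ (sep_subset _ _) hx
  obtain ⟨n, hn⟩ := ((Metric.tendsto_nhds.1 (hF u (fun n => (hu n).1) hlim)) ε hε).exists
  exact absurd hn (not_lt.2 (hu n).2)

theorem IsScatteredSpace.isKRSpace_cp {K : Type*} [TopologicalSpace K] [CompactSpace K]
    [T2Space K] (hK : IsScatteredSpace K) : IsKRSpace (Cp K) := by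
  refine fun F => ⟨fun h C _ => h.continuousOn, fun h => continuous_iff_continuousAt.2 fun f => ?_⟩
  rw [← continuousWithinAt_univ]
  refine continuousWithinAt_of_seq (fun A _ hf => Cp.exists_seq_of_isScatteredSpace hK hf) ?_
  intro u _ hu
  have hc := h _ hu.isCompact_insert_range f (mem_insert _ _)
  exact hc.tendsto.comp (tendsto_nhdsWithin_iff.2 ⟨hu, .of_forall fun n => by simp⟩)

/-! ### Diffuse functionals on non-scattered compacta -/

theorem exists_perfect_of_not_isScatteredSpace {K : Type*} [TopologicalSpace K]
    (hK : ¬ IsScatteredSpace K) : ∃ D : Set K, Perfect D ∧ D.Nonempty := by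
  simp only [IsScatteredSpace, not_forall, not_exists, not_and] at hK
  obtain ⟨S, hS, h⟩ := hK
  refine ⟨closure S, Preperfect.perfect_closure ?_, hS.closure⟩
  rw [preperfect_iff_nhds]
  intro x hx U hU
  by_contra! hcon
  refine h x hx (interior U) isOpen_interior (Subset.antisymm ?_ ?_)
  · exact fun y hy => hcon y ⟨interior_subset hy.1, hy.2⟩
  · rintro _ rfl
    exact ⟨mem_interior_iff_mem_nhds.2 hU, hx⟩

theorem Perfect.exists_dyadic_scheme {K : Type*} [TopologicalSpace K] [T25Space K] {D : Set K}
    (hD : Perfect D) (hne : D.Nonempty) :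
    ∃ P : ℕ → ℕ → Set K, (∀ n k, IsClosed (P n k)) ∧ (∀ n k, (P n k).Nonempty) ∧
      (∀ n k, P (n + 1) k ⊆ P n (k / 2)) ∧
      ∀ n, ∀ k < 2 ^ n, ∀ l < 2 ^ n, k ≠ l → Disjoint (P n k) (P n l) := by
  let T := {C : Set K // Perfect C ∧ C.Nonempty}
  have hsplit : ∀ C : T, ∃ S : Bool → T, (∀ b, (S b).1 ⊆ C.1) ∧
      Disjoint (S false).1 (S true).1 := by
    rintro ⟨C, hC, hCne⟩
    obtain ⟨C₀, C₁, h0, h1, hd⟩ := hC.splitting hCne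
    refine ⟨fun b => bif b then ⟨C₁, h1.1, h1.2.1⟩ else ⟨C₀, h0.1, h0.2.1⟩, ?_, hd⟩
    rintro (_ | _)
    exacts [h0.2.2, h1.2.2]
  choose S hS hSd using hsplit
  -- Cell `k` is a piece of its parent `k / 2`, chosen by the parity of `k`. At level `0` every
  -- index gives `D`, so disjointness needs indices below `2 ^ n`.
  let P : ℕ → ℕ → T := fun n => Nat.rec (motive := fun _ => ℕ → T) (fun _ => ⟨D, hD, hne⟩)
    (fun _ Q k => S (Q (k / 2)) (k % 2 == 1)) n
  refine ⟨fun n k => (P n k).1, fun n k => (P n k).2.1.closed, fun n k => (P n k).2.2,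
    fun n k => hS _ _, fun n => ?_⟩
  induction n with
  | zero => intro k hk l hl hkl; simp at hk hl; omega
  | succ n ih =>
    intro k hk l hl hkl
    rw [pow_succ] at hk hl
    by_cases h : k / 2 = l / 2
    · change Disjoint (S (P n (k / 2)) (k % 2 == 1)).1 (S (P n (l / 2)) (l % 2 == 1)).1
      rw [h]
      rcases Nat.mod_two_eq_zero_or_one k with h0 | h0 <;>
        rcases Nat.mod_two_eq_zero_or_one l with h1 | h1
      · omega
      · simpa [h0, h1] using hSd _
      · simpa [h0, h1] using (hSd _).symm
      · omega
    · exact (ih _ (by omega) _ (by omega) h).mono (hS _ _) (hS _ _)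

/-- Along an ultrafilter, pointwise bounded positive functionals have a limit. -/
theorem exists_ultralimit_functional {K : Type*} [TopologicalSpace K] [CompactSpace K]
    (U : Ultrafilter ℕ) (L : ℕ → C(K, ℝ) →ₗ[ℝ] ℝ) (hL : ∀ n f, |L n f| ≤ ‖f‖) :
    ∃ Λ : C(K, ℝ) →ₗ[ℝ] ℝ, ∀ f, Tendsto (fun n => L n f) U (𝓝 (Λ f)) := by
  have h : ∀ f, ∃ y, Tendsto (fun n => L n f) U (𝓝 y) := by
    intro f
    obtain ⟨y, -, hy⟩ := (isCompact_Icc (a := -‖f‖) (b := ‖f‖)).ultrafilter_le_nhds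
      (U.map fun n => L n f) (le_principal_iff.2 (mem_map.2
        (univ_mem' fun n => abs_le.1 (hL n f))))
    exact ⟨y, hy⟩
  choose Λ hΛ using h
  refine ⟨⟨⟨Λ, fun f g => ?_⟩, fun c f => ?_⟩, hΛ⟩
  · refine tendsto_nhds_unique (hΛ (f + g)) ?_
    simpa using (hΛ f).add (hΛ g)
  · refine tendsto_nhds_unique (hΛ (c • f)) ?_
    simpa using (hΛ f).const_mul c

/-- A non-scattered compact space carries a diffuse normalized positive functional. -/
theorem exists_diffuse_functional {K : Type*} [TopologicalSpace K] [CompactSpace K] [T2Space K]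
    (hK : ¬ IsScatteredSpace K) :
    ∃ Λ : C(K, ℝ) →ₗ[ℝ] ℝ, (∀ f, 0 ≤ f → 0 ≤ Λ f) ∧ Λ 1 = 1 ∧
      ∀ x, ∀ ε : ℝ, 0 < ε → ∃ g : C(K, ℝ), 0 ≤ g ∧ g x = 1 ∧ Λ g ≤ ε := by
  obtain ⟨D, hD, hDne⟩ := exists_perfect_of_not_isScatteredSpace hK
  obtain ⟨P, hPc, hPne, hPs, hPd⟩ := hD.exists_dyadic_scheme hDne
  choose p hp using hPne
  -- Average over one point from each of the `2 ^ n` cells; `Λ` is an ultrafilter limit of these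
  -- averages.
  let L : ℕ → C(K, ℝ) →ₗ[ℝ] ℝ := fun n =>
    ((2 : ℝ) ^ n)⁻¹ • ∑ k ∈ Finset.range (2 ^ n), (ContinuousMap.evalCLM ℝ (p n k)).toLinearMap
  have hLf : ∀ n f, L n f = ((2 : ℝ) ^ n)⁻¹ * ∑ k ∈ Finset.range (2 ^ n), f (p n k) := by
    intro n f
    simp [L]
  have hLb : ∀ n f, |L n f| ≤ ‖f‖ := by
    intro n f
    rw [hLf, abs_mul, abs_of_pos (by positivity), inv_mul_le_iff₀ (by positivity)]
    refine (Finset.abs_sum_le_sum_abs _ _).trans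
      ((Finset.sum_le_card_nsmul _ _ ‖f‖ fun k _ => f.norm_coe_le_norm _).trans ?_)
    simp
  obtain ⟨Λ, hΛ⟩ := exists_ultralimit_functional (hyperfilter ℕ) L hLb
  refine ⟨Λ, fun f hf => ge_of_tendsto' (hΛ f) fun n => ?_, ?_, fun x ε hε => ?_⟩
  · rw [hLf]
    exact mul_nonneg (by positivity) (Finset.sum_nonneg fun k _ => hf _)
  · refine tendsto_nhds_unique (hΛ 1) (tendsto_const_nhds.congr fun n => ?_)
    rw [hLf]
    simp
  · obtain ⟨n, hn⟩ := exists_pow_lt_of_lt_one hε (by norm_num : (2⁻¹ : ℝ) < 1)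
    -- At most one cell of level `n` contains `x`; if none does, `j = 0` is arbitrary.
    obtain ⟨j, hj⟩ : ∃ j, ∀ k < 2 ^ n, k ≠ j → x ∉ P n k := by
      by_cases h : ∃ j < 2 ^ n, x ∈ P n j
      · obtain ⟨j, hj, hx⟩ := h
        exact ⟨j, fun k hk hkj hxk => disjoint_left.1 (hPd n k hk j hj hkj) hxk hx⟩
      · exact ⟨0, fun k hk _ hx => h ⟨k, hk, hx⟩⟩
    let Z := ⋃ k ∈ (Finset.range (2 ^ n)).erase j, P n k
    have hZ : IsClosed Z := isClosed_biUnion_finset fun k _ => hPc n k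
    have hxZ : Disjoint Z {x} := by
      simp only [Z, disjoint_singleton_right, mem_iUnion, Finset.mem_erase, Finset.mem_range]
      rintro ⟨k, ⟨hkj, hk⟩, hx⟩
      exact hj k hk hkj hx
    obtain ⟨g, hg0, hg1, hg⟩ := exists_continuous_zero_one_of_isClosed hZ isClosed_singleton hxZ
    refine ⟨g, fun y => (hg y).1, hg1 rfl, ?_⟩
    have hdesc : ∀ m k, P (n + m) k ⊆ P n (k / 2 ^ m) := by
      intro m
      induction m with
      | zero => simp
      | succ m ih =>
        intro k
        refine (hPs (n + m) k).trans ((ih _).trans ?_)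
        rw [Nat.div_div_eq_div_mul, pow_succ']
    refine le_of_tendsto (hΛ g) ?_
    have hev : ∀ᶠ m in hyperfilter ℕ, n ≤ m :=
      (eventually_ge_atTop n).filter_mono Nat.hyperfilter_le_atTop
    filter_upwards [hev] with m hm
    obtain ⟨m, rfl⟩ := Nat.exists_eq_add_of_le hm
    rw [hLf]
    -- Only the `2 ^ m` descendants of cell `j` contribute, since `g` vanishes on the other cells of
    -- level `n`.
    have h1 : ∑ k ∈ Finset.range (2 ^ (n + m)), g (p (n + m) k) ≤
        ∑ k ∈ Finset.Ico (j * 2 ^ m) ((j + 1) * 2 ^ m), (1 : ℝ) := by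
      rw [← Finset.sum_filter_add_sum_filter_not _ fun k => k / 2 ^ m = j]
      have h2 : ∑ k ∈ Finset.range (2 ^ (n + m)) with ¬ k / 2 ^ m = j, g (p (n + m) k) = 0 := by
        refine Finset.sum_eq_zero fun k hk => hg0 ?_
        simp only [Finset.mem_filter, Finset.mem_range] at hk
        refine mem_biUnion (x := k / 2 ^ m) ?_ (hdesc m k (hp _ _))
        simp only [Finset.coe_erase, Finset.coe_range, Set.mem_sdiff, mem_Iio, mem_singleton_iff]
        exact ⟨Nat.div_lt_of_lt_mul (by rw [← pow_add, add_comm]; exact hk.1), hk.2⟩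
      rw [h2, add_zero]
      refine (Finset.sum_le_sum fun k _ => (hg (p (n + m) k)).2).trans
        (Finset.sum_le_sum_of_subset_of_nonneg ?_ fun _ _ _ => zero_le_one)
      intro k hk
      obtain ⟨-, rfl⟩ := Finset.mem_filter.1 hk
      refine Finset.mem_Ico.2 ⟨Nat.div_mul_le_self _ _, ?_⟩
      rw [mul_comm]
      exact Nat.lt_mul_div_succ _ (by positivity)
    have h3 : ∑ k ∈ Finset.Ico (j * 2 ^ m) ((j + 1) * 2 ^ m), (1 : ℝ) = 2 ^ m := by
      rw [Finset.sum_const, Nat.card_Ico, ← Nat.sub_mul]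
      simp
    calc ((2 : ℝ) ^ (n + m))⁻¹ * ∑ k ∈ Finset.range (2 ^ (n + m)), g (p (n + m) k)
        ≤ ((2 : ℝ) ^ (n + m))⁻¹ * 2 ^ m := by gcongr; exact h1.trans h3.le
      _ = 2⁻¹ ^ n := by rw [pow_add, inv_pow]; field_simp
      _ ≤ ε := hn.le

/-! ### Riesz representation and necessity of scatteredness -/

theorem exists_measure_integral_eq {K : Type*} [TopologicalSpace K] [CompactSpace K] [T2Space K]
    [MeasurableSpace K] [BorelSpace K] (Λ : C(K, ℝ) →ₗ[ℝ] ℝ) (hΛ : ∀ f, 0 ≤ f → 0 ≤ Λ f) :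
    ∃ μ : Measure K, IsFiniteMeasure μ ∧ ∀ f : C(K, ℝ), ∫ x, f x ∂μ = Λ f := by
  let Λ' : CompactlySupportedContinuousMap K ℝ →ₗ[ℝ] ℝ :=
    { toFun := fun f => Λ f.toContinuousMap
      map_add' := fun f g => Λ.map_add f.toContinuousMap g.toContinuousMap
      map_smul' := fun c f => Λ.map_smul c f.toContinuousMap }
  let Λp : CompactlySupportedContinuousMap K ℝ →ₚ[ℝ] ℝ :=
    PositiveLinearMap.mk₀ Λ' fun f hf => hΛ _ hf
  refine ⟨RealRMK.rieszMeasure Λp, ?_, fun f => ?_⟩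
  · infer_instance
  · exact RealRMK.integral_rieszMeasure Λp (CompactlySupportedContinuousMap.continuousMapEquiv f)

theorem isScatteredSpace_of_isKRSpace_cp {K : Type*} [TopologicalSpace K] [CompactSpace K]
    [T2Space K] (h : IsKRSpace (Cp K)) : IsScatteredSpace K := by
  by_contra hK
  obtain ⟨Λ, hΛ, hΛ1, hdiff⟩ := exists_diffuse_functional hK
  borelize K
  obtain ⟨μ, hμ, hint⟩ := exists_measure_integral_eq Λ hΛ
  -- Truncation at `1` supplies the dominating function.
  let F : Cp K → ℝ := fun f => ∫ x, min |f.1 x| 1 ∂μ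
  have hF : Continuous F := by
    refine (h F).2 fun C hC f _ => continuousWithinAt_of_seq
      (fun A hA hf => Cp.exists_seq_of_isCompact hC hA hf) fun u _ hu => ?_
    refine tendsto_integral_of_dominated_convergence (fun _ => 1) (fun n => ?_)
      (integrable_const _) (fun n => .of_forall fun x => ?_) (.of_forall fun x => ?_)
    · exact ((u n).2.abs.min continuous_const).aestronglyMeasurable
    · rw [Real.norm_of_nonneg (by positivity)]
      exact min_le_right _ _
    · exact ((Cp.tendsto_iff.1 hu x).abs).min tendsto_const_nhds
  have hF0 : F ⟨0, continuous_zero⟩ = 0 := by simp [F]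
  have hmem : (⟨0, continuous_zero⟩ : Cp K) ∈ closure {f | 1 / 2 ≤ F f} := by
    rw [Cp.mem_closure_iff]
    intro T ε hε
    -- The bumps at points of `T` have total mass at most `1 / 2`, so `s = 1 - ∑ g x` keeps mass at
    -- least `1 / 2` while being nonpositive on `T`; its positive part vanishes there. The `+ 1`
    -- covers empty `T`.
    choose g hg0 hg1 hgΛ using fun x => hdiff x (1 / (2 * (T.card + 1))) (by positivity)
    have hg0 : ∀ x y, 0 ≤ g x y := fun x y => hg0 x y
    let s : C(K, ℝ) := 1 - ∑ x ∈ T, g x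
    have hs : ∀ y, s y = 1 - ∑ x ∈ T, g x y := fun y => by simp [s]
    have hΛs : 1 / 2 ≤ Λ s := by
      have h1 : ∑ x ∈ T, Λ (g x) ≤ T.card * (1 / (2 * (T.card + 1) : ℝ)) := by
        simpa using Finset.sum_le_card_nsmul T _ _ fun x _ => hgΛ x
      have h2 : (T.card : ℝ) * (1 / (2 * (T.card + 1) : ℝ)) ≤ 1 / 2 := by
        rw [mul_one_div, div_le_div_iff₀ (by positivity) (by positivity)]
        linarith
      simp only [s, map_sub, map_sum, hΛ1]
      linarith
    refine ⟨⟨fun y => max (s y) 0, by fun_prop⟩, ?_, fun x hx => ?_⟩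
    · refine hΛs.trans ((hint s).symm.le.trans ?_)
      refine integral_mono (s.continuous.integrable_of_hasCompactSupport (.of_compactSpace _)) ?_
        fun y => ?_
      · exact ((s.continuous.max continuous_const).abs.min
          continuous_const).integrable_of_hasCompactSupport (.of_compactSpace _)
      · have : s y ≤ 1 := by
          rw [hs]
          linarith [Finset.sum_nonneg fun x (_ : x ∈ T) => hg0 x y]
        exact le_min ((le_max_left _ _).trans (le_abs_self _)) this
    · have : s x ≤ 0 := by
        have := Finset.single_le_sum (fun z (_ : z ∈ T) => hg0 z x) hx
        rw [hg1] at this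
        rw [hs]
        linarith
      simpa [max_eq_right this] using hε
  have hle : (1 / 2 : ℝ) ≤ F ⟨0, continuous_zero⟩ :=
    closure_minimal (t := {f | 1 / 2 ≤ F f}) Subset.rfl (isClosed_le continuous_const hF) hmem
  rw [hF0] at hle
  norm_num at hle

theorem propositionp (K : Type*) [TopologicalSpace K] [CompactSpace K] [T2Space K] :
    IsKRSpace (Cp K) ↔ IsScatteredSpace K :=
  ⟨isScatteredSpace_of_isKRSpace_cp, fun h => h.isKRSpace_cp⟩
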